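/- Let $G=(V,E)$ be an infinite, connected, vertex-transitive simple graph in which every vertex has degree $\Delta$, where $3\le\Delta<\infty$. Fix a vertex $o\in V$ and let $\sigma_n$ be the number of $n$-step self-avoiding walks on $G$ starting at $o$. Let $P$ be the transition matrix of simple random walk on $G$, so that $P(v,w)=1/\Delta$ if $v,w$ are adjacent and $P(v,w)=0$ otherwise. Then: 1. the limit $\mu(G):=\lim_{n\to\infty}\sigma_n^{1/n}$ (the connective constant) exists; 2. there is a largest real number $\lambda$ (the spectral bottom of $I-P$) such that $\langle f,(I-P)f\rangle\ge\lambda\langle f,f\rangle$ for all $f\in\ell^2(V)$; 3. $\displaystyle \mu(G)\ \ge\ (\Delta-1)^{\frac12(1+c\lambda)}$, where $\displaystyle c=\frac{\Delta(\Delta-1)}{(\Delta-2)^2}$; 4. $(\Delta-1)^{\frac12(1+c\lambda)}>\sqrt{\Delta-1}$ if and only if $G$ is non-amenable, that is, if and only if the edge-isoperimetric constant $$\phi(G):=\inf\left\{\frac{|\partial W|}{\Delta\,|W|}:\ W\subset V,\ 0<|W|<\infty\right\}$$ is non-zero, where $\partial W$ denotes the set of edges between $W$ and $V\setminus W$. 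-/

import Mathlib

noncomputable section

namespace SimpleGraph

variable {V : Type*} (G : SimpleGraph V)

/-- `G` is (vertex-)transitive: its automorphism group acts transitively on the vertices. -/
def IsVertexTransitive : Prop :=
  ∀ u v : V, ∃ α : G ≃g G, α u = v

/-- The set of `n`-step self-avoiding walks on `G` starting at `o`
(walks with `n` edges no vertex of which appears more than once). -/
def selfAvoidingWalks (o : V) (n : ℕ) : Set (Σ v : V, G.Walk o v) :=
  {p | p.2.IsPath ∧ p.2.length = n}

/-- The number `σ_n` of `n`-step self-avoiding walks starting at `o`. -/
def sawCount (o : V) (n : ℕ) : ℕ :=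
  (G.selfAvoidingWalks o n).ncard

/-- The connective constant `μ(G) = lim σ_n ^ (1 / n)`, computed at the origin `o`. -/
def connectiveConstant (o : V) : ℝ :=
  Filter.limUnder Filter.atTop (fun n : ℕ => (G.sawCount o n : ℝ) ^ (1 / (n : ℝ)))

/-- The action `f ↦ P f` on functions of the transition matrix `P` of simple random walk on `G`:
`P(v, w) = 1 / deg v` if `w` is a neighbour of `v`, and `P(v, w) = 0` otherwise. -/
def srwOperator [G.LocallyFinite] (f : V → ℝ) (v : V) : ℝ :=
  ∑ w ∈ G.neighborFinset v, (1 / (G.degree v : ℝ)) * f w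

/-- The set of all `l` such that `⟨f, (I - P) f⟩ ≥ l ⟨f, f⟩` for every `f ∈ ℓ²(V)`. -/
def spectralLowerBounds [G.LocallyFinite] : Set ℝ :=
  {l | ∀ f : V → ℝ, Memℓp f 2 →
    l * ∑' v, f v * f v ≤ ∑' v, f v * (f v - G.srwOperator f v)}

/-- The spectral bottom of `I - P`: the largest `l` such that
`⟨f, (I - P) f⟩ ≥ l ⟨f, f⟩` for every `f ∈ ℓ²(V)`. -/
def spectralBottom [G.LocallyFinite] : ℝ :=
  sSup G.spectralLowerBounds

/-- The set of edges between `W` and its complement. -/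
def edgesToCompl (W : Set V) : Set (Sym2 V) :=
  {e | ∃ u ∈ W, ∃ v ∉ W, G.Adj u v ∧ e = s(u, v)}

/-- The edge-isoperimetric constant of a `Δ`-regular graph: the infimum of `|∂W| / (Δ |W|)`
over all finite non-empty sets `W` of vertices. -/
def edgeIsoperimetricConstant (Δ : ℕ) : ℝ :=
  ⨅ W : {W : Finset V // W.Nonempty},
    ((G.edgesToCompl (W.1 : Set V)).ncard : ℝ) / ((Δ : ℝ) * (W.1.card : ℝ))

/-- A `Δ`-regular graph is amenable if its edge-isoperimetric constant is zero. -/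
def IsAmenableOfDegree (Δ : ℕ) : Prop :=
  G.edgeIsoperimetricConstant Δ = 0

end SimpleGraph

end

/-!
Lower bound. By submodularity of the edge boundary, every finite non-empty set of vertices sends out
at least `Δ` edges. Build a self-avoiding walk step by step, keeping the set `W` of its vertices
together with the finite components they cut off, so that the walk is never trapped. A step with `d`
choices raises the number of edges leaving `W` by at most `2 d - Δ`, and Bernoulli's inequality
gives `d ≥ (Δ - 1) ^ ((d - 1) / (Δ - 2))`. Hence the product of the numbers of choices along a walk
is controlled by the final edge boundary, which is at least `κ |W|` when `κ` is an isoperimetric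
constant, and `μ ≥ (Δ - 1) ^ ((1 + κ / (Δ - 2)) / 2)`.

Isoperimetry from the spectrum. The constant `κ = λ Δ (Δ - 1) / (Δ - 2)` is obtained by testing `λ`
on `∑ (Δ - 1) ^ (-k) 1_{B_k}`, where `B_k` is the ball of radius `k` around `W`: no edge leaves two
of the balls, so the energies of the terms add up, and at most `(Δ - 1) ^ k |∂W|` edges leave `B_k`.
Conversely, Cheeger's inequality `φ ^ 2 / 2 ≤ λ` follows from the co-area inequality for `f ^ 2` and
Cauchy–Schwarz.
-/

namespace ConnectiveConstant

open Finset

section EdgeBoundary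

variable {V : Type*} [DecidableEq V]

/-- The number of edges between the finite set `W` and its complement, counted at their endpoints
in `W` so that it is a natural number without any finiteness side condition. -/
def cutSize (G : SimpleGraph V) [G.LocallyFinite] (W : Finset V) : ℕ :=
  ∑ u ∈ W, #(G.neighborFinset u \ W)

variable {G : SimpleGraph V} [G.LocallyFinite] {W U : Finset V}

theorem ncard_edgesToCompl (W : Finset V) :
    (G.edgesToCompl (W : Set V)).ncard = cutSize G W := by
  have himage : G.edgesToCompl (W : Set V) =
      ((W.sigma fun u => G.neighborFinset u \ W).image fun p => s(p.1, p.2) : Finset (Sym2 V)) := by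
    ext e
    simp only [SimpleGraph.edgesToCompl, Set.mem_ofPred_eq, coe_image, Set.mem_image, mem_coe,
      mem_sigma, mem_sdiff, SimpleGraph.mem_neighborFinset, Sigma.exists]
    constructor
    · rintro ⟨u, hu, v, hv, huv, rfl⟩
      exact ⟨u, v, ⟨hu, huv, hv⟩, rfl⟩
    · rintro ⟨u, v, ⟨hu, huv, hv⟩, rfl⟩
      exact ⟨u, hu, v, hv, huv, rfl⟩
  rw [himage, Set.ncard_coe_finset, card_image_of_injOn, card_sigma, cutSize]
  rintro ⟨u, v⟩ huv ⟨u', v'⟩ huv' heq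
  simp only [coe_sigma, Set.mem_sigma_iff, mem_coe, mem_sdiff] at huv huv'
  rcases Sym2.eq_iff.1 heq with ⟨rfl, rfl⟩ | ⟨rfl, rfl⟩
  · rfl
  · exact absurd huv.1 huv'.2.2

theorem cutSize_pos_iff : 0 < cutSize G W ↔ ∃ u ∈ W, ∃ v ∉ W, G.Adj u v := by
  simp only [cutSize, sum_pos_iff, card_pos, Finset.Nonempty, mem_sdiff,
    SimpleGraph.mem_neighborFinset, and_comm]

theorem cutSize_pos [Infinite V] (hconn : G.Connected) (hW : W.Nonempty) : 0 < cutSize G W := by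
  obtain ⟨u, hu⟩ := hW
  obtain ⟨v, hv⟩ := Infinite.exists_notMem_finset W
  obtain ⟨p⟩ := hconn.preconnected u v
  obtain ⟨d, -, hfst, hsnd⟩ := p.exists_boundary_dart (W : Set V) hu hv
  exact cutSize_pos_iff.2 ⟨d.fst, hfst, d.snd, hsnd, d.adj⟩

theorem sum_card_neighborFinset_inter_comm (X Y : Finset V) :
    ∑ u ∈ X, #(G.neighborFinset u ∩ Y) = ∑ u ∈ Y, #(G.neighborFinset u ∩ X) := by
  classical
  have habove : ∀ (Z : Finset V) (u : V), G.neighborFinset u ∩ Z = Z.bipartiteAbove G.Adj u := by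
    intro Z u
    ext v
    simp [and_comm]
  have hbelow : ∀ u, X.bipartiteBelow G.Adj u = X.bipartiteAbove G.Adj u := by
    intro u
    ext v
    simp [G.adj_comm]
  simp only [habove, ← hbelow]
  exact sum_card_bipartiteAbove_eq_sum_card_bipartiteBelow G.Adj

theorem cutSize_eq_sum_sdiff_union_add (h : Disjoint W U) :
    cutSize G W =
      ∑ u ∈ W, #(G.neighborFinset u \ (W ∪ U)) + ∑ u ∈ W, #(G.neighborFinset u ∩ U) := by
  rw [cutSize, ← sum_add_distrib]
  refine sum_congr rfl fun u _ => ?_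
  have hinter : (G.neighborFinset u \ W) ∩ U = G.neighborFinset u ∩ U := by
    rw [inter_comm, ← inter_sdiff_assoc, inter_comm, sdiff_eq_self_of_disjoint]
    exact h.symm.mono_left inter_subset_right
  rw [← card_sdiff_add_card_inter (G.neighborFinset u \ W) U, sdiff_sdiff_left, sup_eq_union,
    hinter]

theorem cutSize_union_add_cutSize (h : Disjoint W U) :
    cutSize G (W ∪ U) + cutSize G U =
      cutSize G W + 2 * ∑ u ∈ U, #(G.neighborFinset u \ (W ∪ U)) := by
  rw [cutSize_eq_sum_sdiff_union_add h, cutSize_eq_sum_sdiff_union_add h.symm, union_comm U W,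
    sum_card_neighborFinset_inter_comm U W, cutSize, sum_union h]
  ring

theorem cutSize_inter_add_cutSize_union_le (A B : Finset V) :
    cutSize G (A ∩ B) + cutSize G (A ∪ B) ≤ cutSize G A + cutSize G B := by
  have hsum : ∀ X ⊆ A ∪ B,
      cutSize G X = ∑ u ∈ A ∪ B, if u ∈ X then #(G.neighborFinset u \ X) else 0 := by
    intro X hX
    rw [← sum_filter, filter_mem_eq_inter, inter_eq_right.2 hX, cutSize]
  rw [hsum _ (inter_subset_left.trans subset_union_left), hsum _ subset_rfl,
    hsum _ subset_union_left, hsum _ subset_union_right, ← sum_add_distrib, ← sum_add_distrib]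
  refine sum_le_sum fun u hu => ?_
  have hA : #(G.neighborFinset u \ (A ∪ B)) ≤ #(G.neighborFinset u \ A) :=
    card_le_card (sdiff_subset_sdiff subset_rfl subset_union_left)
  have hB : #(G.neighborFinset u \ (A ∪ B)) ≤ #(G.neighborFinset u \ B) :=
    card_le_card (sdiff_subset_sdiff subset_rfl subset_union_right)
  have hAB : #(G.neighborFinset u \ (A ∩ B)) + #(G.neighborFinset u \ (A ∪ B)) =
      #(G.neighborFinset u \ A) + #(G.neighborFinset u \ B) := by
    rw [sdiff_inter_distrib_right, sdiff_union_distrib, card_union_add_card_inter]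
  by_cases huA : u ∈ A <;> by_cases huB : u ∈ B <;> simp_all

end EdgeBoundary

section VertexTransitive

variable {V : Type*} {G : SimpleGraph V} [G.LocallyFinite]

theorem map_neighborFinset (α : G ≃g G) (v : V) :
    (G.neighborFinset v).map α.toEquiv.toEmbedding = G.neighborFinset (α v) := by
  rw [← coe_inj, coe_map, SimpleGraph.coe_neighborFinset, SimpleGraph.coe_neighborFinset]
  exact α.image_neighborSet

variable [DecidableEq V]

theorem card_neighborFinset_sdiff_map (α : G ≃g G) (v : V) (W : Finset V) :
    #(G.neighborFinset (α v) \ W.map α.toEquiv.toEmbedding) = #(G.neighborFinset v \ W) := by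
  rw [← map_neighborFinset, ← Finset.map_sdiff, card_map]

theorem cutSize_map (α : G ≃g G) (W : Finset V) :
    cutSize G (W.map α.toEquiv.toEmbedding) = cutSize G W := by
  rw [cutSize, sum_map]
  exact sum_congr rfl fun v _ => card_neighborFinset_sdiff_map α v W

/-- An edge atom is a non-empty finite set of vertices with as few outgoing edges as possible and,
among these, with as few vertices as possible. -/
def IsEdgeAtom (G : SimpleGraph V) [G.LocallyFinite] (A : Finset V) : Prop :=
  MinimalFor Finset.Nonempty (fun W : Finset V => toLex (cutSize G W, #W)) A

variable {A W : Finset V}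

theorem IsEdgeAtom.cutSize_le (hA : IsEdgeAtom G A) (hW : W.Nonempty) :
    cutSize G A ≤ cutSize G W := by
  by_contra! hlt
  exact hA.not_lt hW (Prod.Lex.toLex_lt_toLex.2 (.inl hlt))

theorem IsEdgeAtom.card_le (hA : IsEdgeAtom G A) (hW : W.Nonempty)
    (hcut : cutSize G W ≤ cutSize G A) : #A ≤ #W := by
  by_contra! hlt
  exact hA.not_lt hW (Prod.Lex.toLex_lt_toLex.2 (.inr ⟨hcut.antisymm (hA.cutSize_le hW), hlt⟩))

/-- By submodularity of the cut size, the intersection of an atom with a translate of it is again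
minimal. -/
theorem IsEdgeAtom.map_eq_self (hA : IsEdgeAtom G A) {α : G ≃g G}
    (hne : (A ∩ A.map α.toEquiv.toEmbedding).Nonempty) : A.map α.toEquiv.toEmbedding = A := by
  set B := A.map α.toEquiv.toEmbedding
  have hB : cutSize G B = cutSize G A := cutSize_map α A
  have hsubmod := cutSize_inter_add_cutSize_union_le (G := G) A B
  have hunion : cutSize G A ≤ cutSize G (A ∪ B) :=
    hA.cutSize_le (hne.mono (inter_subset_left.trans subset_union_left))
  have hcard : #A ≤ #(A ∩ B) := hA.card_le hne (by omega)
  have hAB : A ⊆ B := inter_eq_left.1 (eq_of_subset_of_card_le inter_subset_left hcard)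
  exact (eq_of_subset_of_card_le hAB (card_map _).le).symm

theorem IsEdgeAtom.cutSize_eq_card_mul (htrans : G.IsVertexTransitive) (hA : IsEdgeAtom G A)
    {a : V} (ha : a ∈ A) : cutSize G A = #A * #(G.neighborFinset a \ A) := by
  refine sum_const_nat fun u hu => ?_
  obtain ⟨α, rfl⟩ := htrans a u
  have hAα := hA.map_eq_self (α := α) ⟨_, mem_inter.2 ⟨hu, mem_map_of_mem _ ha⟩⟩
  rw [← card_neighborFinset_sdiff_map α a A, hAα]

theorem le_cutSize [Infinite V] (hconn : G.Connected) (htrans : G.IsVertexTransitive) {Δ : ℕ}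
    (hreg : G.IsRegularOfDegree Δ) (hW : W.Nonempty) : Δ ≤ cutSize G W := by
  obtain ⟨A, hA⟩ : ∃ A, IsEdgeAtom G A := exists_minimalFor_of_wellFoundedLT _ _ ⟨W, hW⟩
  refine le_trans ?_ (hA.cutSize_le hW)
  obtain ⟨a, ha⟩ := hA.prop
  have hcut := hA.cutSize_eq_card_mul htrans ha
  have hpos : 0 < #(G.neighborFinset a \ A) :=
    Nat.pos_of_mul_pos_left (hcut ▸ cutSize_pos hconn hA.prop)
  have hdeg : #(G.neighborFinset a \ A) + #(G.neighborFinset a ∩ A) = Δ := by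
    rw [card_sdiff_add_card_inter, SimpleGraph.card_neighborFinset_eq_degree, hreg a]
  have hlt : #(G.neighborFinset a ∩ A) < #A :=
    card_lt_card ⟨inter_subset_right, fun h => by simpa using (mem_inter.1 (h ha)).1⟩
  calc Δ = #(G.neighborFinset a \ A) + #(G.neighborFinset a ∩ A) := hdeg.symm
    _ ≤ (#(G.neighborFinset a ∩ A) + 1) * #(G.neighborFinset a \ A) := by nlinarith
    _ ≤ #A * #(G.neighborFinset a \ A) := Nat.mul_le_mul_right _ hlt
    _ = cutSize G A := hcut.symm

end VertexTransitive

section Filling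

variable {V : Type*} [DecidableEq V] {G : SimpleGraph V} {W W' : Finset V} {x : V}

/-- A finite set `W` is saturated if no finite component is left after deleting it: every
non-empty finite set disjoint from `W` has an edge to a vertex outside both sets. -/
def Saturated (G : SimpleGraph V) (W : Finset V) : Prop :=
  ∀ U : Finset V, U.Nonempty → Disjoint W U → ∃ u ∈ U, ∃ v ∉ W ∪ U, G.Adj u v

/-- `W'` consists of `W`, the vertex `x`, and further vertices all of whose neighbours lie in `W'`.
A self-avoiding walk that steps from outside `W` to `x` and never enters `W'` again can still be
continued for ever if `W'` is saturated. -/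
structure IsFilling (G : SimpleGraph V) (W : Finset V) (x : V) (W' : Finset V) : Prop where
  subset : W ⊆ W'
  mem : x ∈ W'
  eq_of_adj : ∀ u ∈ W', u ∉ W → ∀ v ∉ W', G.Adj u v → u = x

theorem isFilling_insert (W : Finset V) (x : V) : IsFilling G W x (insert x W) where
  subset := subset_insert x W
  mem := mem_insert_self x W
  eq_of_adj _ hu huW _ _ _ := (mem_insert.1 hu).resolve_right huW

theorem IsFilling.union (h : IsFilling G W x W') {U : Finset V}
    (hU : ∀ u ∈ U, ∀ v ∉ W' ∪ U, ¬ G.Adj u v) : IsFilling G W x (W' ∪ U) where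
  subset := h.subset.trans subset_union_left
  mem := mem_union_left U h.mem
  eq_of_adj u hu huW v hv huv := by
    rcases mem_union.1 hu with huW' | huU
    · exact h.eq_of_adj u huW' huW v (fun hvW' => hv (mem_union_left U hvW')) huv
    · exact absurd huv (hU u huU v hv)

variable [G.LocallyFinite]

/-- Adding a finite component of the complement to a filling gives a filling with fewer outgoing
edges, so a filling with the fewest outgoing edges is saturated. -/
theorem exists_isFilling_saturated (hcut : ∀ U : Finset V, U.Nonempty → 0 < cutSize G U)
    (W : Finset V) (x : V) : ∃ W', IsFilling G W x W' ∧ Saturated G W' := by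
  obtain ⟨W', hW', hmin⟩ := exists_minimalFor_of_wellFoundedLT (IsFilling G W x) (cutSize G)
    ⟨_, isFilling_insert W x⟩
  refine ⟨W', hW', fun U hU hdisj => ?_⟩
  by_contra! hclosed
  have hout : ∑ u ∈ U, #(G.neighborFinset u \ (W' ∪ U)) = 0 := by
    refine sum_eq_zero fun u hu => card_eq_zero.2 (sdiff_eq_empty_iff_subset.2 fun v hv => ?_)
    by_contra hvU
    exact hclosed u hu v hvU ((G.mem_neighborFinset u v).1 hv)
  have hunion := cutSize_union_add_cutSize (G := G) hdisj
  have hle : cutSize G W' ≤ cutSize G (W' ∪ U) := by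
    by_contra! hlt
    exact hlt.not_ge (hmin (hW'.union hclosed) hlt.le)
  have hpos := hcut U hU
  omega

theorem IsFilling.cutSize_add_le {m : ℕ} (hcut : ∀ U : Finset V, U.Nonempty → m ≤ cutSize G U)
    (h : IsFilling G W x W') (hx : x ∉ W) :
    cutSize G W' + m ≤ cutSize G W + 2 * #(G.neighborFinset x \ W') := by
  have hxU : x ∈ W' \ W := mem_sdiff.2 ⟨h.mem, hx⟩
  have hunion := cutSize_union_add_cutSize (G := G) (disjoint_sdiff (s := W) (t := W'))
  rw [union_sdiff_of_subset h.subset, sum_eq_single_of_mem x hxU] at hunion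
  · have hm := hcut (W' \ W) ⟨x, hxU⟩
    omega
  · intro u hu hux
    obtain ⟨huW', huW⟩ := mem_sdiff.1 hu
    refine card_eq_zero.2 (sdiff_eq_empty_iff_subset.2 fun v hv => ?_)
    by_contra hvW'
    exact hux (h.eq_of_adj u huW' huW v hvW' ((G.mem_neighborFinset u v).1 hv))

theorem IsFilling.nonempty_neighborFinset_sdiff (h : IsFilling G W x W') (hx : x ∉ W)
    (hW : Saturated G W) : (G.neighborFinset x \ W').Nonempty := by
  obtain ⟨u, hu, v, hv, huv⟩ := hW (W' \ W) ⟨x, mem_sdiff.2 ⟨h.mem, hx⟩⟩ disjoint_sdiff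
  rw [union_sdiff_of_subset h.subset] at hv
  obtain ⟨huW', huW⟩ := mem_sdiff.1 hu
  obtain rfl := h.eq_of_adj u huW' huW v hv huv
  exact ⟨v, mem_sdiff.2 ⟨(G.mem_neighborFinset u v).2 huv, hv⟩⟩

end Filling

section AvoidingWalks

variable {V : Type*} {G : SimpleGraph V}

/-- The self-avoiding walks with `n` steps that start at `x` and do not visit `W`. -/
def avoidingWalks (G : SimpleGraph V) (W : Finset V) (x : V) (n : ℕ) : Set (Σ v : V, G.Walk x v) :=
  {p ∈ G.selfAvoidingWalks x n | ∀ v ∈ p.2.support, v ∉ W}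

theorem cons_mem_avoidingWalks {W W' : Finset V} {x y : V} {n : ℕ} (hW : W ⊆ W') (hx : x ∉ W)
    (hx' : x ∈ W') (hxy : G.Adj x y) {p : Σ v : V, G.Walk y v} (hp : p ∈ avoidingWalks G W' y n) :
    ⟨p.1, .cons hxy p.2⟩ ∈ avoidingWalks G W x (n + 1) := by
  obtain ⟨⟨hpath, hlength⟩, havoid⟩ := hp
  refine ⟨⟨hpath.cons fun hmem => havoid x hmem hx', by simpa using hlength⟩, fun v hv => ?_⟩
  rcases List.mem_cons.1 (SimpleGraph.Walk.support_cons hxy p.2 ▸ hv) with rfl | hv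
  · exact hx
  · exact fun hvW => havoid v hv (hW hvW)

variable [G.LocallyFinite]

theorem finite_setOf_walk_length_eq (n : ℕ) :
    ∀ x : V, {p : Σ v : V, G.Walk x v | p.2.length = n}.Finite := by
  induction n with
  | zero =>
    intro x
    refine (Set.finite_singleton (⟨x, .nil⟩ : Σ v : V, G.Walk x v)).subset ?_
    rintro ⟨v, p⟩ hp
    cases p with
    | nil => rfl
    | cons h p => exact absurd hp (Nat.succ_ne_zero _)
  | succ n ih =>
    intro x
    refine (Set.finite_iUnion fun y : G.neighborSet x =>
      (ih y).image fun q => (⟨q.1, .cons y.2 q.2⟩ : Σ v : V, G.Walk x v)).subset ?_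
    rintro ⟨v, p⟩ hp
    cases p with
    | nil => exact absurd hp.symm (Nat.succ_ne_zero n)
    | @cons _ y _ h p => exact Set.mem_iUnion.2 ⟨⟨y, h⟩, ⟨v, p⟩, Nat.succ_injective hp, rfl⟩

theorem finite_selfAvoidingWalks (x : V) (n : ℕ) : (G.selfAvoidingWalks x n).Finite :=
  (finite_setOf_walk_length_eq n x).subset fun _ hp => hp.2

theorem finite_avoidingWalks (W : Finset V) (x : V) (n : ℕ) : (avoidingWalks G W x n).Finite :=
  (finite_selfAvoidingWalks x n).subset fun _ hp => hp.1

theorem ncard_avoidingWalks_le_sawCount (W : Finset V) (x : V) (n : ℕ) :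
    (avoidingWalks G W x n).ncard ≤ G.sawCount x n :=
  Set.ncard_le_ncard (fun _ hp => hp.1) (finite_selfAvoidingWalks x n)

theorem one_le_ncard_avoidingWalks_zero {W : Finset V} {x : V} (hx : x ∉ W) :
    1 ≤ (avoidingWalks G W x 0).ncard := by
  refine (Set.ncard_pos (finite_avoidingWalks W x 0)).2 ⟨⟨x, .nil⟩, ⟨.nil, rfl⟩, fun v hv => ?_⟩
  exact List.mem_singleton.1 hv ▸ hx

theorem ncard_avoidingWalks_le_ncard_setOf_snd_eq {W W' : Finset V} {x y : V} (hW : W ⊆ W')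
    (hx : x ∉ W) (hx' : x ∈ W') (hxy : G.Adj x y) (n : ℕ) :
    (avoidingWalks G W' y n).ncard ≤ {p ∈ avoidingWalks G W x (n + 1) | p.2.snd = y}.ncard := by
  refine Set.ncard_le_ncard_of_injOn (fun p => ⟨p.1, .cons hxy p.2⟩)
    (fun p hp => ⟨cons_mem_avoidingWalks hW hx hx' hxy hp, SimpleGraph.Walk.snd_cons p.2 hxy⟩) ?_
    ((finite_avoidingWalks W x (n + 1)).subset fun _ hp => hp.1)
  rintro ⟨v, p⟩ - ⟨v', p'⟩ - heq
  cases heq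
  rfl

theorem sum_ncard_avoidingWalks_le [DecidableEq V] {W W' : Finset V} {x : V} (hW : W ⊆ W')
    (hx : x ∉ W) (hx' : x ∈ W') (n : ℕ) :
    ∑ y ∈ G.neighborFinset x \ W', (avoidingWalks G W' y n).ncard ≤
      (avoidingWalks G W x (n + 1)).ncard := by
  have hfin := finite_avoidingWalks (G := G) W x (n + 1)
  calc ∑ y ∈ G.neighborFinset x \ W', (avoidingWalks G W' y n).ncard
      ≤ ∑ y ∈ G.neighborFinset x \ W', #{p ∈ hfin.toFinset | p.2.snd = y} := by
        refine sum_le_sum fun y hy => ?_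
        have hxy := (G.mem_neighborFinset x y).1 (mem_sdiff.1 hy).1
        refine (ncard_avoidingWalks_le_ncard_setOf_snd_eq hW hx hx' hxy n).trans_eq ?_
        rw [← Set.ncard_coe_finset]
        simp
    _ ≤ #hfin.toFinset := by
        rw [sum_card_fiberwise_eq_card_filter]
        exact card_filter_le _ _
    _ = (avoidingWalks G W x (n + 1)).ncard := (Set.ncard_eq_toFinset_card _ hfin).symm

end AvoidingWalks

section SawCount

open Filter Topology

variable {V : Type*} {G : SimpleGraph V} [G.LocallyFinite]

theorem sawCount_apply_le (α : G ≃g G) (u : V) (n : ℕ) :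
    G.sawCount u n ≤ G.sawCount (α u) n := by
  refine Set.ncard_le_ncard_of_injOn (fun p => ⟨α p.1, p.2.map α.toHom⟩) ?_ ?_
    (finite_selfAvoidingWalks _ n)
  · rintro ⟨v, p⟩ ⟨hp, hn⟩
    exact ⟨hp.map α.injective, (SimpleGraph.Walk.length_map _ _).trans hn⟩
  · rintro ⟨v, p⟩ - ⟨v', p'⟩ - heq
    obtain ⟨hv, hp⟩ := Sigma.mk.inj_iff.1 heq
    obtain rfl := α.injective hv
    exact congrArg _
      (SimpleGraph.Walk.map_injective_of_injective α.injective _ _ (eq_of_heq hp))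

theorem sawCount_eq (htrans : G.IsVertexTransitive) (u v : V) (n : ℕ) :
    G.sawCount u n = G.sawCount v n := by
  obtain ⟨α, rfl⟩ := htrans u v
  refine (sawCount_apply_le α u n).antisymm ?_
  simpa only [RelIso.symm_apply_apply] using sawCount_apply_le α.symm (α u) n

theorem sawCount_add_le (htrans : G.IsVertexTransitive) (o : V) (m n : ℕ) :
    G.sawCount o (m + n) ≤ G.sawCount o m * G.sawCount o n := by
  have hfin := finite_selfAvoidingWalks (G := G) o m
  let continuations : (Σ v : V, G.Walk o v) → Set (Σ v : V, G.Walk o v) := fun q =>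
    (fun r => ⟨r.1, q.2.append r.2⟩) '' G.selfAvoidingWalks q.1 n
  have hsub : G.selfAvoidingWalks o (m + n) ⊆ ⋃ q ∈ hfin.toFinset, continuations q := by
    rintro ⟨v, p⟩ ⟨hp, hlength : p.length = m + n⟩
    refine Set.mem_biUnion (x := ⟨_, p.take m⟩)
      (hfin.mem_toFinset.2 ⟨hp.take m, ?_⟩) ⟨⟨v, p.drop m⟩, ⟨hp.drop m, ?_⟩, ?_⟩
    · simp only [SimpleGraph.Walk.take_length, hlength]
      omega
    · simp only [SimpleGraph.Walk.drop_length, hlength]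
      omega
    · simp only [SimpleGraph.Walk.append_take_drop_eq]
  calc G.sawCount o (m + n)
      ≤ (⋃ q ∈ hfin.toFinset, continuations q).ncard :=
        Set.ncard_le_ncard hsub (hfin.toFinset.finite_toSet.biUnion fun q _ =>
          (finite_selfAvoidingWalks q.1 n).image _)
    _ ≤ ∑ q ∈ hfin.toFinset, (continuations q).ncard := set_ncard_biUnion_le _ _
    _ ≤ ∑ _q ∈ hfin.toFinset, G.sawCount o n := by
        refine sum_le_sum fun q _ => ?_
        rw [sawCount_eq htrans o q.1]
        exact Set.ncard_image_le (finite_selfAvoidingWalks q.1 n)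
    _ = G.sawCount o m * G.sawCount o n := by
        rw [sum_const, smul_eq_mul, ← Set.ncard_eq_toFinset_card _ hfin, ← SimpleGraph.sawCount]

theorem exists_tendsto_rpow_one_div {a : ℕ → ℝ} (ha : ∀ n, 1 ≤ a n)
    (hmul : ∀ m n, a (m + n) ≤ a m * a n) :
    ∃ L, Tendsto (fun n : ℕ => a n ^ (1 / (n : ℝ))) atTop (𝓝 L) := by
  have hpos : ∀ n, 0 < a n := fun n => one_pos.trans_le (ha n)
  have hsub : Subadditive fun n => Real.log (a n) := fun m n =>
    (Real.log_le_log (hpos _) (hmul m n)).trans_eq (Real.log_mul (hpos m).ne' (hpos n).ne')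
  have hlim := hsub.tendsto_lim ⟨0, by
    rintro _ ⟨n, rfl⟩
    exact div_nonneg (Real.log_nonneg (ha n)) n.cast_nonneg⟩
  refine ⟨Real.exp hsub.lim, ((Real.continuous_exp.tendsto _).comp hlim).congr fun n => ?_⟩
  rw [Real.rpow_def_of_pos (hpos n), mul_one_div, Function.comp_apply]

theorem rpow_le_of_tendsto_rpow_one_div {a : ℕ → ℝ} {b e C L : ℝ} (hb : 0 < b)
    (ha : ∀ n : ℕ, b ^ (e * n - C) ≤ a n)
    (hL : Tendsto (fun n : ℕ => a n ^ (1 / (n : ℝ))) atTop (𝓝 L)) : b ^ e ≤ L := by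
  have hexp : Tendsto (fun n : ℕ => b ^ (e - C / n)) atTop (𝓝 (b ^ e)) := by
    have hlim := (tendsto_const_nhds (x := e)).sub (tendsto_const_div_atTop_nhds_zero_nat C)
    rw [sub_zero] at hlim
    exact (Real.continuousAt_const_rpow hb.ne').tendsto.comp hlim
  refine le_of_tendsto_of_tendsto hexp hL ?_
  filter_upwards [eventually_ne_atTop 0] with n hn
  calc b ^ (e - C / n) = (b ^ (e * n - C)) ^ (1 / (n : ℝ)) := by
        rw [← Real.rpow_mul hb.le, mul_one_div, sub_div,
          mul_div_cancel_right₀ _ (Nat.cast_ne_zero.2 hn)]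
    _ ≤ a n ^ (1 / (n : ℝ)) := by
        gcongr
        exact ha n

theorem tendsto_connectiveConstant (htrans : G.IsVertexTransitive) {o : V}
    (hpos : ∀ n, 0 < G.sawCount o n) :
    Tendsto (fun n : ℕ => (G.sawCount o n : ℝ) ^ (1 / (n : ℝ))) atTop
      (𝓝 (G.connectiveConstant o)) :=
  tendsto_nhds_limUnder (exists_tendsto_rpow_one_div (fun n => Nat.one_le_cast.2 (hpos n))
    fun m n => by exact_mod_cast sawCount_add_le htrans o m n)

end SawCount

section Growth

variable {V : Type*} [DecidableEq V] {G : SimpleGraph V} [G.LocallyFinite] {Δ : ℕ} {κ : ℝ}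

theorem rpow_sub_one_div_sub_one_le {b d : ℝ} (hd : 1 ≤ d) (hdb : d ≤ b) (hb : 1 < b) :
    b ^ ((d - 1) / (b - 1)) ≤ d := by
  have hb' : 0 < b - 1 := sub_pos.2 hb
  have hbernoulli := rpow_one_add_le_one_add_mul_self (s := b - 1) (p := (d - 1) / (b - 1))
    (by linarith) (div_nonneg (sub_nonneg.2 hd) hb'.le) ((div_le_one hb').2 (by linarith))
  rwa [div_mul_cancel₀ _ hb'.ne', add_sub_cancel, add_sub_cancel] at hbernoulli

/-- The inductive step of the walk count: `d` is the number of choices for the next step, `w` and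
`c` are the cardinality and the cut size of the set to be avoided, before and after filling it. -/
theorem rpow_div_le_mul_rpow_div {D d w w' c c' n : ℝ} (hD : 2 < D) (hd : 1 ≤ d) (hdD : d ≤ D - 1)
    (hκ : 0 ≤ κ) (hw : w + 1 ≤ w') (hc : c' + D ≤ c + 2 * d) :
    (D - 1) ^ ((κ * (w + (n + 1)) + (D - 2) * (n + 1) - c) / (2 * (D - 2))) ≤
      d * (D - 1) ^ ((κ * (w' + n) + (D - 2) * n - c') / (2 * (D - 2))) := by
  have hexp : (κ * (w + (n + 1)) + (D - 2) * (n + 1) - c) / (2 * (D - 2)) ≤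
      (d - 1) / (D - 1 - 1) + (κ * (w' + n) + (D - 2) * n - c') / (2 * (D - 2)) := by
    rw [← mul_div_mul_left (d - 1) _ two_ne_zero, show D - 1 - 1 = D - 2 by ring, ← add_div,
      div_le_div_iff_of_pos_right (by linarith)]
    nlinarith [mul_le_mul_of_nonneg_left hw hκ]
  refine (Real.rpow_le_rpow_of_exponent_le (by linarith) hexp).trans ?_
  rw [Real.rpow_add (by linarith)]
  exact mul_le_mul_of_nonneg_right (rpow_sub_one_div_sub_one_le hd hdD (by linarith))
    (Real.rpow_nonneg (by linarith) _)

theorem card_neighborFinset_sdiff_lt (hreg : G.IsRegularOfDegree Δ) {W : Finset V} {w x : V}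
    (hw : w ∈ W) (hwx : G.Adj w x) : #(G.neighborFinset x \ W) < Δ := by
  rw [← hreg x, ← SimpleGraph.card_neighborFinset_eq_degree]
  exact card_lt_card (sdiff_subset.ssubset_of_mem_notMem
    ((G.mem_neighborFinset x w).2 hwx.symm) fun h => (mem_sdiff.1 h).2 hw)

theorem rpow_le_ncard_avoidingWalks (hreg : G.IsRegularOfDegree Δ) (hΔ : 3 ≤ Δ)
    (hcut : ∀ U : Finset V, U.Nonempty → Δ ≤ cutSize G U) (hκ₀ : 0 ≤ κ)
    (hκ : ∀ U : Finset V, κ * #U ≤ cutSize G U) (n : ℕ) :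
    ∀ {W : Finset V} {w x : V}, Saturated G W → x ∉ W → w ∈ W → G.Adj w x →
      ((Δ : ℝ) - 1) ^ ((κ * (#W + n) + (Δ - 2) * n - cutSize G W) / (2 * (Δ - 2))) ≤
        ((avoidingWalks G W x n).ncard : ℝ) := by
  have hΔ' : (3 : ℝ) ≤ Δ := by exact_mod_cast hΔ
  induction n with
  | zero =>
    intro W w x _ hx _ _
    refine le_trans (Real.rpow_le_one_of_one_le_of_nonpos (by linarith) ?_)
      (Nat.one_le_cast.2 (one_le_ncard_avoidingWalks_zero hx))
    refine div_nonpos_of_nonpos_of_nonneg ?_ (by linarith)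
    simpa using hκ W
  | succ n ih =>
    intro W w x hW hx hw hwx
    obtain ⟨W', hfill, hW'⟩ :=
      exists_isFilling_saturated (fun U hU => (by omega : 0 < Δ).trans_le (hcut U hU)) W x
    have hcard : (#W : ℝ) + 1 ≤ #W' := by
      exact_mod_cast card_lt_card ⟨hfill.subset, fun h => hx (h hfill.mem)⟩
    set d := #(G.neighborFinset x \ W')
    have hd : (1 : ℝ) ≤ d :=
      Nat.one_le_cast.2 (card_pos.2 (hfill.nonempty_neighborFinset_sdiff hx hW))
    have hdΔ : (d : ℝ) ≤ Δ - 1 := by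
      rw [le_sub_iff_add_le]
      exact_mod_cast card_neighborFinset_sdiff_lt hreg (hfill.subset hw) hwx
    have hgrow : (cutSize G W' : ℝ) + Δ ≤ cutSize G W + 2 * d := by
      exact_mod_cast hfill.cutSize_add_le hcut hx
    calc ((Δ : ℝ) - 1) ^ ((κ * (#W + (n + 1 : ℕ)) + (Δ - 2) * (n + 1 : ℕ) - cutSize G W) /
          (2 * (Δ - 2)))
        ≤ d * (Δ - 1) ^ ((κ * (#W' + n) + (Δ - 2) * n - cutSize G W') / (2 * (Δ - 2))) := by
          rw [Nat.cast_succ]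
          exact rpow_div_le_mul_rpow_div (by linarith) hd hdΔ hκ₀ hcard hgrow
      _ ≤ ∑ y ∈ G.neighborFinset x \ W', ((avoidingWalks G W' y n).ncard : ℝ) := by
          rw [← nsmul_eq_mul]
          refine card_nsmul_le_sum _ _ _ fun y hy => ?_
          obtain ⟨hxy, hy'⟩ := mem_sdiff.1 hy
          exact ih hW' hy' hfill.mem ((G.mem_neighborFinset x y).1 hxy)
      _ ≤ ((avoidingWalks G W x (n + 1)).ncard : ℝ) := by
          exact_mod_cast sum_ncard_avoidingWalks_le hfill.subset hx hfill.mem n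

theorem exists_forall_rpow_le_sawCount (htrans : G.IsVertexTransitive)
    (hreg : G.IsRegularOfDegree Δ) (hΔ : 3 ≤ Δ)
    (hcut : ∀ U : Finset V, U.Nonempty → Δ ≤ cutSize G U) (hκ₀ : 0 ≤ κ)
    (hκ : ∀ U : Finset V, κ * #U ≤ cutSize G U) (o : V) :
    ∃ C : ℝ, ∀ n : ℕ, ((Δ : ℝ) - 1) ^ ((1 + κ / (Δ - 2)) / 2 * n - C) ≤ G.sawCount o n := by
  have hΔ' : (3 : ℝ) ≤ Δ := by exact_mod_cast hΔ
  have hcut_pos : ∀ U : Finset V, U.Nonempty → 0 < cutSize G U :=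
    fun U hU => (by omega : 0 < Δ).trans_le (hcut U hU)
  obtain ⟨W, hfill, hW⟩ := exists_isFilling_saturated hcut_pos ∅ o
  obtain ⟨w, hw, x, hx, hwx⟩ := cutSize_pos_iff.1 (hcut_pos W ⟨o, hfill.mem⟩)
  refine ⟨cutSize G W / (2 * (Δ - 2)), fun n => ?_⟩
  calc ((Δ : ℝ) - 1) ^ ((1 + κ / (Δ - 2)) / 2 * n - cutSize G W / (2 * (Δ - 2)))
      ≤ (Δ - 1) ^ ((κ * (#W + n) + (Δ - 2) * n - cutSize G W) / (2 * (Δ - 2))) := by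
        refine Real.rpow_le_rpow_of_exponent_le (by linarith) ?_
        rw [show (1 + κ / ((Δ : ℝ) - 2)) / 2 * n = (κ * n + (Δ - 2) * n) / (2 * (Δ - 2)) by
          field_simp [show (Δ : ℝ) - 2 ≠ 0 by linarith]; ring, ← sub_div,
          div_le_div_iff_of_pos_right (by linarith)]
        nlinarith [mul_nonneg hκ₀ (Nat.cast_nonneg (α := ℝ) #W)]
    _ ≤ ((avoidingWalks G W x n).ncard : ℝ) :=
        rpow_le_ncard_avoidingWalks hreg hΔ hcut hκ₀ hκ n hW hx hw hwx
    _ ≤ G.sawCount x n := by exact_mod_cast ncard_avoidingWalks_le_sawCount W x n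
    _ = G.sawCount o n := by rw [sawCount_eq htrans x o]

end Growth

section DartSums

variable {V : Type*} {G : SimpleGraph V}

/-- A dart amounts to a vertex together with a neighbour of it, so that sums over darts can be
evaluated vertex by vertex. -/
def sigmaNeighborSetEquivDart (G : SimpleGraph V) : (Σ v, G.neighborSet v) ≃ G.Dart where
  toFun p := G.dartOfNeighborSet p.1 p.2
  invFun d := ⟨d.fst, d.snd, d.adj⟩

theorem hasSum_dart_swap {F : V → V → ℝ} {a : ℝ}
    (hF : HasSum (fun d : G.Dart => F d.fst d.snd) a) :
    HasSum (fun d : G.Dart => F d.snd d.fst) a :=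
  (Equiv.hasSum_iff SimpleGraph.Dart.symm_involutive.toPerm).2 hF

variable [G.LocallyFinite]

theorem hasSum_neighborFinset (F : V → V → ℝ) (v : V) :
    HasSum (fun w : G.neighborSet v => F v w) (∑ w ∈ G.neighborFinset v, F v w) := by
  rw [SimpleGraph.neighborFinset_def, ← sum_set_coe]
  exact hasSum_fintype _

theorem hasSum_sum_neighborFinset {F : V → V → ℝ} (hF : Summable fun d : G.Dart => F d.fst d.snd) :
    HasSum (fun v => ∑ w ∈ G.neighborFinset v, F v w) (∑' d : G.Dart, F d.fst d.snd) :=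
  ((sigmaNeighborSetEquivDart G).hasSum_iff.2 hF.hasSum).sigma (hasSum_neighborFinset F)

theorem hasSum_comp_fst {h : V → ℝ} {a : ℝ} (hh : HasSum (fun v => G.degree v * h v) a) :
    HasSum (fun d : G.Dart => h d.fst) a := by
  have hfiber : ∀ (h : V → ℝ) (v : V),
      HasSum (fun _ : G.neighborSet v => h v) (G.degree v * h v) := by
    intro h v
    simpa using hasSum_neighborFinset (G := G) (fun v _ => h v) v
  refine (sigmaNeighborSetEquivDart G).hasSum_iff.1 (hh.sigma_of_hasSum (hfiber h) ?_)
  refine Summable.of_norm ((summable_sigma_of_nonneg fun _ => norm_nonneg _).2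
    ⟨fun v => (hfiber (fun v => ‖h v‖) v).summable, ?_⟩)
  refine hh.summable.norm.congr fun v => ?_
  rw [norm_mul, Real.norm_natCast]
  exact (hfiber (fun v => ‖h v‖) v).tsum_eq.symm

theorem hasSum_comp_snd {h : V → ℝ} {a : ℝ} (hh : HasSum (fun v => G.degree v * h v) a) :
    HasSum (fun d : G.Dart => h d.snd) a :=
  hasSum_dart_swap (F := fun v _ => h v) (hasSum_comp_fst hh)

end DartSums

section DirichletEnergy

variable {V : Type*} {G : SimpleGraph V} {f : V → ℝ}

/-- The Dirichlet energy of `f`, as a sum over oriented edges: every edge counts twice. -/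
noncomputable def dirichletEnergy (G : SimpleGraph V) (f : V → ℝ) : ℝ :=
  ∑' d : G.Dart, (f d.fst - f d.snd) ^ 2

variable [G.LocallyFinite]

theorem degree_mul_srwOperator (f : V → ℝ) (v : V) :
    G.degree v * G.srwOperator f v = ∑ w ∈ G.neighborFinset v, f w := by
  rw [SimpleGraph.srwOperator, ← mul_sum, ← mul_assoc]
  rcases (G.neighborFinset v).eq_empty_or_nonempty with h | h
  · simp [h]
  · have hdeg : (G.degree v : ℝ) ≠ 0 := by
      rw [← G.card_neighborFinset_eq_degree]
      exact_mod_cast h.card_pos.ne'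
    rw [mul_one_div_cancel hdeg, one_mul]

theorem summable_sq_sub (hf : Summable fun v => G.degree v * f v ^ 2) :
    Summable fun d : G.Dart => (f d.fst - f d.snd) ^ 2 := by
  refine Summable.of_nonneg_of_le (fun d => sq_nonneg _) (fun d => ?_)
    (((hasSum_comp_fst hf.hasSum).add (hasSum_comp_snd hf.hasSum)).summable.mul_left 2)
  nlinarith [sq_nonneg (f d.fst + f d.snd)]

theorem dirichletEnergy_eq_two_mul_tsum (hf : Summable fun v => G.degree v * f v ^ 2) :
    dirichletEnergy G f = 2 * ∑' v, G.degree v * (f v * (f v - G.srwOperator f v)) := by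
  have hfst := hasSum_comp_fst hf.hasSum
  have hsnd := hasSum_comp_snd hf.hasSum
  have hmul : Summable fun d : G.Dart => f d.fst * f d.snd := by
    refine (hfst.add hsnd).summable.of_norm_bounded fun d => abs_le.2 ⟨?_, ?_⟩ <;>
      nlinarith [sq_nonneg (f d.fst - f d.snd), sq_nonneg (f d.fst + f d.snd)]
  have henergy : dirichletEnergy G f =
      2 * (∑' v, G.degree v * f v ^ 2 - ∑' d : G.Dart, f d.fst * f d.snd) := by
    rw [mul_sub, two_mul (∑' v, _), ← ((hfst.add hsnd).sub (hmul.hasSum.mul_left 2)).tsum_eq]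
    exact tsum_congr fun d => by ring
  rw [henergy,
    ← (hf.hasSum.sub (hasSum_sum_neighborFinset (F := fun v w => f v * f w) hmul)).tsum_eq]
  refine congrArg (2 * ·) (tsum_congr fun v => ?_)
  rw [← mul_sum, ← degree_mul_srwOperator]
  ring

theorem memℓp_two_iff_summable_sq : Memℓp f 2 ↔ Summable fun v => f v ^ 2 := by
  simp [memℓp_gen_iff]

theorem mem_spectralLowerBounds_iff {Δ : ℕ} (hreg : G.IsRegularOfDegree Δ) (hΔ : 0 < Δ) {l : ℝ} :
    l ∈ G.spectralLowerBounds ↔ ∀ f : V → ℝ, (Summable fun v => f v ^ 2) →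
      l * (2 * Δ * ∑' v, f v ^ 2) ≤ dirichletEnergy G f := by
  have hΔ' : (0 : ℝ) < 2 * Δ := by positivity
  refine forall_congr' fun f => ?_
  rw [memℓp_two_iff_summable_sq]
  refine forall_congr' fun hf => ?_
  rw [dirichletEnergy_eq_two_mul_tsum (by simpa only [hreg.degree_eq] using hf.mul_left _)]
  simp only [hreg.degree_eq, tsum_mul_left, ← sq]
  rw [← mul_assoc 2, mul_left_comm, mul_le_mul_iff_right₀ hΔ']

theorem bddAbove_spectralLowerBounds [Nonempty V] : BddAbove G.spectralLowerBounds := by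
  classical
  obtain ⟨o⟩ := ‹Nonempty V›
  set f : V → ℝ := Pi.single o 1
  refine ⟨∑' v, f v * (f v - G.srwOperator f v), fun l hl => ?_⟩
  have hmem : Memℓp f 2 :=
    memℓp_two_iff_summable_sq.2 (summable_of_ne_finset_zero (s := {o}) fun v hv => by
      simp [f, show v ≠ o by simpa using hv])
  have hnorm : ∑' v, f v * f v = 1 := by
    rw [tsum_eq_single o fun v hv => by simp [f, hv]]
    simp [f]
  simpa only [hnorm, mul_one] using hl f hmem

theorem isClosed_spectralLowerBounds : IsClosed G.spectralLowerBounds := by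
  simp only [SimpleGraph.spectralLowerBounds, Set.ofPred_forall]
  exact isClosed_iInter fun f => isClosed_iInter fun _ =>
    isClosed_le (continuous_mul_const _) continuous_const

theorem isGreatest_spectralBottom [Nonempty V] (hne : G.spectralLowerBounds.Nonempty) :
    IsGreatest G.spectralLowerBounds G.spectralBottom :=
  isClosed_spectralLowerBounds.isGreatest_csSup hne bddAbove_spectralLowerBounds

end DirichletEnergy

section Coarea

variable {V : Type*} {G : SimpleGraph V} [G.LocallyFinite] {g : V → ℝ} {κ : ℝ}

theorem summable_abs_sub (hg : Summable fun v => G.degree v * g v) :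
    Summable fun d : G.Dart => |g d.fst - g d.snd| :=
  ((hasSum_comp_fst hg.hasSum).sub (hasSum_comp_snd hg.hasSum)).summable.abs

theorem summable_abs_sub_of_forall_notMem {S : Finset V} (hS : ∀ v ∉ S, g v = 0) :
    Summable fun d : G.Dart => |g d.fst - g d.snd| :=
  summable_abs_sub (summable_of_ne_finset_zero (s := S) fun v hv => by rw [hS v hv, mul_zero])

theorem abs_sub_eq_add_of_forall_le {S : Finset V} {m : ℝ} (hm : 0 ≤ m) (hmin : ∀ v ∈ S, m ≤ g v)
    (hS : ∀ v ∉ S, g v = 0) (v w : V) :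
    |g v - g w| = |(g v - m * (S : Set V).indicator 1 v) - (g w - m * (S : Set V).indicator 1 w)| +
      m * |(S : Set V).indicator (1 : V → ℝ) v - (S : Set V).indicator 1 w| := by
  by_cases hv : v ∈ S <;> by_cases hw : w ∈ S
  · simp [hv, hw]
  · have := hmin v hv
    simp [hv, hw, hS w hw, abs_of_nonneg (hm.trans this), abs_of_nonneg (sub_nonneg.2 this)]
  · have := hmin w hw
    simp [hv, hw, hS v hv, abs_of_nonneg (hm.trans this), abs_of_nonneg (sub_nonneg.2 this),
      abs_sub_comm m]
  · simp [hv, hw]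

variable [DecidableEq V]

theorem hasSum_abs_sub_indicator (S : Finset V) :
    HasSum (fun d : G.Dart => |(S : Set V).indicator (1 : V → ℝ) d.fst -
      (S : Set V).indicator 1 d.snd|) (2 * cutSize G S) := by
  set F : V → V → ℝ := fun v w => if v ∈ S ∧ w ∉ S then 1 else 0
  have hfst : Summable fun d : G.Dart => (S : Set V).indicator (1 : V → ℝ) d.fst :=
    (hasSum_comp_fst (h := (S : Set V).indicator 1)
      (summable_of_ne_finset_zero (s := S) fun v hv => by simp [hv]).hasSum).summable
  have hF : Summable fun d : G.Dart => F d.fst d.snd := by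
    refine hfst.of_nonneg_of_le (fun d => ?_) fun d => ?_ <;>
      by_cases h : d.fst ∈ S <;> by_cases h' : d.snd ∈ S <;> simp [F, h, h']
  have hcut : ∑' d : G.Dart, F d.fst d.snd = cutSize G S := by
    rw [← (hasSum_sum_neighborFinset (F := F) hF).tsum_eq,
      tsum_eq_sum (s := S) fun v hv => sum_eq_zero fun w _ => by simp [F, hv], cutSize,
      Nat.cast_sum]
    refine sum_congr rfl fun v hv => ?_
    simp [F, hv, sdiff_eq_filter, ← sum_boole]
  have hout : HasSum (fun d : G.Dart => F d.fst d.snd) (cutSize G S) := hcut ▸ hF.hasSum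
  have hin : HasSum (fun d : G.Dart => F d.snd d.fst) (cutSize G S) :=
    hasSum_dart_swap hout
  rw [two_mul]
  convert hout.add hin using 2 with d
  by_cases h : d.fst ∈ S <;> by_cases h' : d.snd ∈ S <;> simp [F, h, h']

/- Peeling off the lowest level `m = min_S g` replaces `g` by `g - m 1_S`, which has smaller
support, and lowers both sides by comparable amounts. -/
theorem sum_le_tsum_abs_sub (hκ : ∀ U : Finset V, κ * #U ≤ cutSize G U) (S : Finset V)
    (hg : ∀ v, 0 ≤ g v) (hS : ∀ v ∉ S, g v = 0) :
    2 * κ * ∑ v ∈ S, g v ≤ ∑' d : G.Dart, |g d.fst - g d.snd| := by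
  induction S using Finset.strongInduction generalizing g with
  | H S ih =>
  rcases S.eq_empty_or_nonempty with rfl | hne
  · simpa using tsum_nonneg fun d : G.Dart => abs_nonneg (g d.fst - g d.snd)
  obtain ⟨a, ha, hmin⟩ := S.exists_min_image g hne
  set g' : V → ℝ := fun v => g v - g a * (S : Set V).indicator 1 v
  have hg' : ∀ v, 0 ≤ g' v := by
    intro v
    by_cases hv : v ∈ S
    · simpa [g', hv] using hmin v hv
    · simpa [g', hv] using hg v
  have hsupp : ∀ v ∉ S.erase a, g' v = 0 := by
    intro v hv
    by_cases hva : v = a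
    · simp [g', hva, ha]
    · have hvS : v ∉ S := fun h => hv (mem_erase.2 ⟨hva, h⟩)
      simp [g', hvS, hS v hvS]
  have hsplit : ∑' d : G.Dart, |g d.fst - g d.snd| =
      ∑' d : G.Dart, |g' d.fst - g' d.snd| + g a * (2 * cutSize G S) := by
    rw [tsum_congr fun d : G.Dart => abs_sub_eq_add_of_forall_le (hg a) hmin hS d.fst d.snd]
    exact ((summable_abs_sub_of_forall_notMem hsupp).hasSum.add
      ((hasSum_abs_sub_indicator S).mul_left (g a))).tsum_eq
  have hsum : ∑ v ∈ S, g v = ∑ v ∈ S.erase a, g' v + g a * #S := by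
    rw [sum_erase S (by simp [g', ha]), sum_sub_distrib, ← mul_sum,
      sum_indicator_subset _ subset_rfl]
    simp
  rw [hsplit, hsum]
  linarith [ih _ (erase_ssubset ha) hg' hsupp, mul_le_mul_of_nonneg_left (hκ S) (hg a)]

theorem sum_sub_le_tsum_abs_sub (hκ₀ : 0 ≤ κ) (hκ : ∀ U : Finset V, κ * #U ≤ cutSize G U)
    (hg : Summable g) (hdiff : Summable fun d : G.Dart => |g d.fst - g d.snd|) (F : Finset V)
    {ε : ℝ} (hε : 0 < ε) :
    2 * κ * ∑ v ∈ F, (g v - ε) ≤ ∑' d : G.Dart, |g d.fst - g d.snd| := by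
  set h : V → ℝ := fun v => max (g v - ε) 0
  have hfin : {v | ¬ g v < ε}.Finite := hg.tendsto_cofinite_zero.eventually (gt_mem_nhds hε)
  set S := F ∪ hfin.toFinset
  have hS : ∀ v ∉ S, h v = 0 := by
    intro v hv
    have : g v < ε := by simpa using fun h => hv (mem_union_right F (hfin.mem_toFinset.2 h))
    exact max_eq_right (by linarith)
  calc 2 * κ * ∑ v ∈ F, (g v - ε)
      ≤ 2 * κ * ∑ v ∈ S, h v := by
        gcongr
        exact (sum_le_sum fun v _ => le_max_left _ _).trans
          (sum_le_sum_of_subset_of_nonneg subset_union_left fun v _ _ => le_max_right _ _)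
    _ ≤ ∑' d : G.Dart, |h d.fst - h d.snd| :=
        sum_le_tsum_abs_sub hκ S (fun v => le_max_right _ _) hS
    _ ≤ ∑' d : G.Dart, |g d.fst - g d.snd| := by
        refine (summable_abs_sub_of_forall_notMem hS).tsum_le_tsum (fun d => ?_) hdiff
        simpa using abs_max_sub_max_le_abs (g d.fst - ε) (g d.snd - ε) 0

theorem tsum_le_tsum_abs_sub (hκ₀ : 0 ≤ κ) (hκ : ∀ U : Finset V, κ * #U ≤ cutSize G U)
    (hg : Summable g) (hdiff : Summable fun d : G.Dart => |g d.fst - g d.snd|) :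
    2 * κ * ∑' v, g v ≤ ∑' d : G.Dart, |g d.fst - g d.snd| := by
  rw [← tsum_mul_left]
  refine (hg.mul_left _).tsum_le_of_sum_le fun F => ?_
  have hlim : Filter.Tendsto (fun ε => 2 * κ * ∑ v ∈ F, (g v - ε)) (nhdsWithin 0 (Set.Ioi 0))
      (nhds (2 * κ * ∑ v ∈ F, (g v - 0))) :=
    (Continuous.tendsto (by fun_prop) 0).mono_left nhdsWithin_le_nhds
  simp only [sub_zero, mul_sum] at hlim
  refine le_of_tendsto hlim (eventually_mem_nhdsWithin.mono fun ε hε => ?_)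
  simpa only [mul_sum] using sum_sub_le_tsum_abs_sub hκ₀ hκ hg hdiff F hε

end Coarea

section Cheeger

variable {V : Type*} {G : SimpleGraph V} [G.LocallyFinite]

theorem mul_tsum_abs_sq_sub_sq_le {f : V → ℝ}
    (hf : Summable fun v => G.degree v * f v ^ 2) (φ : ℝ) :
    φ * ∑' d : G.Dart, |f d.fst ^ 2 - f d.snd ^ 2| ≤
      dirichletEnergy G f + φ ^ 2 * ∑' v, G.degree v * f v ^ 2 := by
  have hfst := hasSum_comp_fst hf.hasSum
  have hsnd := hasSum_comp_snd hf.hasSum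
  have henergy := (summable_sq_sub hf).hasSum
  have hbound := henergy.add ((hfst.add hsnd).mul_left (φ ^ 2 / 2))
  rw [← add_self_div_two (∑' v, G.degree v * f v ^ 2), mul_div_assoc', mul_div_right_comm]
  refine hasSum_le (fun d => ?_) ((summable_abs_sub hf).hasSum.mul_left φ) hbound
  -- `φ |x| |y| ≤ x² + φ² y² / 4` with `x = f v - f w` and `y = f v + f w`
  rw [sq_sub_sq, abs_mul]
  nlinarith [sq_nonneg (|f d.fst - f d.snd| - φ / 2 * |f d.fst + f d.snd|),
    sq_abs (f d.fst - f d.snd), sq_abs (f d.fst + f d.snd),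
    mul_nonneg (sq_nonneg φ) (sq_nonneg (f d.fst - f d.snd))]

theorem sq_div_two_mem_spectralLowerBounds [DecidableEq V] {Δ : ℕ} {φ : ℝ}
    (hreg : G.IsRegularOfDegree Δ) (hΔ : 0 < Δ)
    (hφ₀ : 0 ≤ φ) (hφ : ∀ U : Finset V, φ * Δ * #U ≤ cutSize G U) :
    φ ^ 2 / 2 ∈ G.spectralLowerBounds := by
  refine (mem_spectralLowerBounds_iff hreg hΔ).2 fun f hf => ?_
  have hf' : Summable fun v => G.degree v * f v ^ 2 := by
    simpa only [hreg.degree_eq] using hf.mul_left _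
  have hdiff := summable_abs_sub hf'
  have hcoarea := tsum_le_tsum_abs_sub (by positivity) hφ hf hdiff
  have hcauchy := mul_tsum_abs_sq_sub_sq_le hf' φ
  simp only [hreg.degree_eq, tsum_mul_left] at hcauchy
  linarith [mul_le_mul_of_nonneg_left hcoarea hφ₀]

end Cheeger

section BallProfile

variable {V : Type*} [DecidableEq V] {G : SimpleGraph V} [G.LocallyFinite] {S W : Finset V}
  {f : V → ℝ} {Δ : ℕ}

/-- The vertices at distance at most one from `S`; its iterates are the balls around `S`. -/
def closedNbhd (G : SimpleGraph V) [G.LocallyFinite] (S : Finset V) : Finset V :=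
  S ∪ S.biUnion fun v => G.neighborFinset v

theorem subset_closedNbhd : S ⊆ closedNbhd G S :=
  subset_union_left

theorem neighborFinset_subset_closedNbhd {v : V} (hv : v ∈ S) :
    G.neighborFinset v ⊆ closedNbhd G S :=
  (subset_biUnion_of_mem (G.neighborFinset ·) hv).trans subset_union_right

theorem exists_adj_of_mem_closedNbhd_sdiff {u : V} (hu : u ∈ closedNbhd G S \ S) :
    ∃ v ∈ S, G.Adj v u := by
  obtain ⟨hu, huS⟩ := mem_sdiff.1 hu
  simpa using (mem_union.1 hu).resolve_left huS

theorem card_closedNbhd_sdiff_le : #(closedNbhd G S \ S) ≤ cutSize G S := by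
  refine le_trans (card_le_card fun u hu => ?_) (card_biUnion_le (t := (G.neighborFinset · \ S)))
  obtain ⟨v, hv, hvu⟩ := exists_adj_of_mem_closedNbhd_sdiff hu
  exact mem_biUnion.2 ⟨v, hv, mem_sdiff.2 ⟨by simpa using hvu, (mem_sdiff.1 hu).2⟩⟩

theorem cutSize_closedNbhd_le (hreg : G.IsRegularOfDegree Δ) :
    cutSize G (closedNbhd G S) ≤ (Δ - 1) * cutSize G S := by
  have hinner : ∀ u ∈ S, #(G.neighborFinset u \ closedNbhd G S) = 0 := fun u hu =>
    card_eq_zero.2 (sdiff_eq_empty_iff_subset.2 (neighborFinset_subset_closedNbhd hu))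
  have houter : ∀ u ∈ closedNbhd G S \ S, #(G.neighborFinset u \ closedNbhd G S) ≤ Δ - 1 := by
    intro u hu
    obtain ⟨v, hv, hvu⟩ := exists_adj_of_mem_closedNbhd_sdiff hu
    exact Nat.le_sub_one_of_lt
      (card_neighborFinset_sdiff_lt hreg (subset_closedNbhd hv) hvu)
  calc cutSize G (closedNbhd G S)
      = ∑ u ∈ closedNbhd G S \ S, #(G.neighborFinset u \ closedNbhd G S) := by
        rw [cutSize, ← sum_sdiff subset_closedNbhd, sum_eq_zero hinner, add_zero]
    _ ≤ #(closedNbhd G S \ S) * (Δ - 1) := sum_le_card_nsmul _ _ _ houter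
    _ ≤ (Δ - 1) * cutSize G S := by
        rw [mul_comm]
        exact Nat.mul_le_mul_left _ card_closedNbhd_sdiff_le

theorem cutSize_iterate_closedNbhd_le (hreg : G.IsRegularOfDegree Δ) (W : Finset V) (k : ℕ) :
    cutSize G ((closedNbhd G)^[k] W) ≤ (Δ - 1) ^ k * cutSize G W := by
  induction k with
  | zero => simp
  | succ k ih =>
    rw [Function.iterate_succ_apply', pow_succ', mul_assoc]
    exact (cutSize_closedNbhd_le hreg).trans (Nat.mul_le_mul_left _ ih)

theorem subset_iterate_closedNbhd (k : ℕ) : W ⊆ (closedNbhd G)^[k] W :=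
  Function.id_le_iterate_of_id_le (fun _ => subset_closedNbhd) k W

/- An edge leaving `S` never meets the support of `f`: the two gradients have disjoint supports and
the energies add up. -/
theorem dirichletEnergy_add_indicator {U : Finset V} (hU : ∀ v ∉ U, f v = 0)
    (hf : ∀ v, f v ≠ 0 → v ∈ S ∧ G.neighborFinset v ⊆ S) (c : ℝ) :
    dirichletEnergy G (fun v => f v + c * (S : Set V).indicator 1 v) =
      dirichletEnergy G f + c ^ 2 * (2 * cutSize G S) := by
  have henergy : Summable fun d : G.Dart => (f d.fst - f d.snd) ^ 2 :=
    summable_sq_sub (summable_of_ne_finset_zero (s := U) fun v hv => by simp [hU v hv])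
  have hzero : ∀ v w, G.Adj v w → w ∉ S → f v = 0 ∧ f w = 0 := by
    intro v w hvw hw
    constructor <;> by_contra h
    · exact hw ((hf v h).2 (by simpa using hvw))
    · exact hw (hf w h).1
  refine Eq.trans (tsum_congr fun d => ?_)
    (henergy.hasSum.add ((hasSum_abs_sub_indicator S).mul_left (c ^ 2))).tsum_eq
  by_cases hv : d.fst ∈ S <;> by_cases hw : d.snd ∈ S
  · simp [hv, hw]
  · simp [hv, hw, hzero _ _ d.adj hw]
  · simp [hv, hw, hzero _ _ d.adj.symm hv]
  · simp [hv, hw]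

/-- The step function `∑_{k < K} β ^ k 1_{B_k}`, where `B_k` is the ball of radius `k` around `W`;
it is the test function for the spectral lower bounds. -/
noncomputable def ballProfile (G : SimpleGraph V) [G.LocallyFinite] (W : Finset V) (β : ℝ) (K : ℕ)
    (v : V) : ℝ :=
  ∑ k ∈ range K, β ^ k * ((closedNbhd G)^[k] W : Set V).indicator 1 v

theorem ballProfile_succ (W : Finset V) (β : ℝ) (K : ℕ) :
    ballProfile G W β (K + 1) = fun v =>
      ballProfile G W β K v + β ^ K * ((closedNbhd G)^[K] W : Set V).indicator 1 v :=
  funext fun _ => sum_range_succ _ _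

theorem mem_of_ballProfile_ne_zero {β : ℝ} {K : ℕ} {v : V} (h : ballProfile G W β K v ≠ 0) :
    v ∈ (closedNbhd G)^[K] W ∧ G.neighborFinset v ⊆ (closedNbhd G)^[K] W := by
  obtain ⟨k, hk, hne⟩ := exists_ne_zero_of_sum_ne_zero h
  have hv : v ∈ (closedNbhd G)^[k] W := Set.mem_of_indicator_ne_zero (right_ne_zero_of_mul hne)
  have hsub : (closedNbhd G)^[k + 1] W ⊆ (closedNbhd G)^[K] W :=
    Function.monotone_iterate_of_id_le (fun _ => subset_closedNbhd) (mem_range.1 hk) W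
  rw [Function.iterate_succ_apply'] at hsub
  exact ⟨hsub (subset_closedNbhd hv), (neighborFinset_subset_closedNbhd hv).trans hsub⟩

theorem ballProfile_eq_zero {β : ℝ} {K : ℕ} {v : V} (hv : v ∉ (closedNbhd G)^[K] W) :
    ballProfile G W β K v = 0 := by
  by_contra h
  exact hv (mem_of_ballProfile_ne_zero h).1

theorem ballProfile_of_mem {v : V} (hv : v ∈ W) (β : ℝ) (K : ℕ) :
    ballProfile G W β K v = ∑ k ∈ range K, β ^ k := by
  refine sum_congr rfl fun k _ => ?_
  rw [Set.indicator_of_mem (mem_coe.2 (subset_iterate_closedNbhd k hv)), Pi.one_apply, mul_one]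

theorem dirichletEnergy_ballProfile (W : Finset V) (β : ℝ) (K : ℕ) :
    dirichletEnergy G (ballProfile G W β K) =
      ∑ k ∈ range K, (β ^ k) ^ 2 * (2 * cutSize G ((closedNbhd G)^[k] W)) := by
  induction K with
  | zero => simp [dirichletEnergy, ballProfile]
  | succ K ih =>
    rw [ballProfile_succ, dirichletEnergy_add_indicator (fun _ => ballProfile_eq_zero)
      (fun _ => mem_of_ballProfile_ne_zero), ih, sum_range_succ]

theorem dirichletEnergy_ballProfile_le (hreg : G.IsRegularOfDegree Δ) (hΔ : 1 < Δ) (W : Finset V)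
    (K : ℕ) : dirichletEnergy G (ballProfile G W ((Δ : ℝ) - 1)⁻¹ K) ≤
      2 * cutSize G W * ∑ k ∈ range K, ((Δ : ℝ) - 1)⁻¹ ^ k := by
  have hpos : (0 : ℝ) < Δ - 1 := sub_pos.2 (Nat.one_lt_cast.2 hΔ)
  rw [dirichletEnergy_ballProfile, mul_sum]
  refine sum_le_sum fun k _ => ?_
  have hcut : (cutSize G ((closedNbhd G)^[k] W) : ℝ) ≤ ((Δ : ℝ) - 1) ^ k * cutSize G W := by
    rw [← Nat.cast_pred (by lia)]
    exact_mod_cast cutSize_iterate_closedNbhd_le hreg W k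
  calc (((Δ : ℝ) - 1)⁻¹ ^ k) ^ 2 * (2 * cutSize G ((closedNbhd G)^[k] W))
      ≤ (((Δ : ℝ) - 1)⁻¹ ^ k) ^ 2 * (2 * (((Δ : ℝ) - 1) ^ k * cutSize G W)) := by gcongr
    _ = 2 * cutSize G W * ((Δ : ℝ) - 1)⁻¹ ^ k := by
        rw [inv_pow]
        field_simp

theorem card_mul_sq_le_tsum_ballProfile_sq (W : Finset V) (β : ℝ) (K : ℕ) :
    #W * (∑ k ∈ range K, β ^ k) ^ 2 ≤ ∑' v, ballProfile G W β K v ^ 2 := by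
  rw [tsum_eq_sum (s := (closedNbhd G)^[K] W) fun v hv => by simp [ballProfile_eq_zero hv],
    ← nsmul_eq_mul, ← sum_const]
  refine (sum_congr rfl fun v hv => ?_).trans_le
    (sum_le_sum_of_subset_of_nonneg (subset_iterate_closedNbhd K) fun _ _ _ => sq_nonneg _)
  rw [ballProfile_of_mem hv]

theorem mul_card_mul_geom_sum_le_cutSize (hreg : G.IsRegularOfDegree Δ) (hΔ : 1 < Δ) {l : ℝ}
    (hl : l ∈ G.spectralLowerBounds) (hl₀ : 0 ≤ l) (W : Finset V) (K : ℕ) :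
    l * Δ * #W * ∑ k ∈ range K, ((Δ : ℝ) - 1)⁻¹ ^ k ≤ cutSize G W := by
  set s := ∑ k ∈ range K, ((Δ : ℝ) - 1)⁻¹ ^ k
  have hβ : 0 ≤ ((Δ : ℝ) - 1)⁻¹ := inv_nonneg.2 (sub_nonneg.2 (Nat.one_le_cast.2 hΔ.le))
  have hs : 0 ≤ s := sum_nonneg fun k _ => pow_nonneg hβ k
  rcases hs.eq_or_lt with hs | hs
  · simp [← hs]
  have htest := (mem_spectralLowerBounds_iff hreg (by lia)).1 hl (ballProfile G W ((Δ : ℝ) - 1)⁻¹ K)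
    (summable_of_ne_finset_zero (s := (closedNbhd G)^[K] W) fun v hv => by
      simp [ballProfile_eq_zero hv])
  refine le_of_mul_le_mul_left ?_ (mul_pos two_pos hs)
  calc 2 * s * (l * Δ * #W * s) = l * (2 * Δ * (#W * s ^ 2)) := by ring
    _ ≤ l * (2 * Δ * ∑' v, ballProfile G W ((Δ : ℝ) - 1)⁻¹ K v ^ 2) := by
        gcongr
        exact card_mul_sq_le_tsum_ballProfile_sq W _ K
    _ ≤ 2 * cutSize G W * s := htest.trans (dirichletEnergy_ballProfile_le hreg hΔ W K)
    _ = 2 * s * cutSize G W := by ring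

theorem mul_card_le_cutSize (hreg : G.IsRegularOfDegree Δ) (hΔ : 3 ≤ Δ) {l : ℝ}
    (hl : l ∈ G.spectralLowerBounds) (hl₀ : 0 ≤ l) (W : Finset V) :
    l * (Δ * (Δ - 1) / (Δ - 2)) * #W ≤ cutSize G W := by
  have hΔ' : (3 : ℝ) ≤ Δ := by exact_mod_cast hΔ
  have hgeom : HasSum (fun k => ((Δ : ℝ) - 1)⁻¹ ^ k) ((Δ - 1) / (Δ - 2)) := by
    convert hasSum_geometric_of_lt_one (inv_nonneg.2 (by linarith))
      (inv_lt_one_of_one_lt₀ (by linarith : 1 < (Δ : ℝ) - 1)) using 1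
    have : (Δ : ℝ) - 1 ≠ 0 := by linarith
    rw [← inv_div, inv_inj]
    field_simp
    ring
  rw [show l * (Δ * (Δ - 1) / (Δ - 2)) * #W = l * Δ * #W * ((Δ - 1) / (Δ - 2)) by ring]
  exact le_of_tendsto' (hgeom.tendsto_sum_nat.const_mul _) fun K =>
    mul_card_mul_geom_sum_le_cutSize hreg (by lia) hl hl₀ W K

end BallProfile

section Isoperimetry

theorem edgeIsoperimetricConstant_nonneg {V : Type*} (G : SimpleGraph V) (Δ : ℕ) :
    0 ≤ G.edgeIsoperimetricConstant Δ :=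
  Real.iInf_nonneg fun _ => by positivity

variable {V : Type*} {G : SimpleGraph V} [G.LocallyFinite] {Δ : ℕ}

theorem edgeIsoperimetricConstant_mul_le [DecidableEq V] (hΔ : 0 < Δ) (W : Finset V) :
    G.edgeIsoperimetricConstant Δ * Δ * #W ≤ cutSize G W := by
  rcases W.eq_empty_or_nonempty with rfl | hW
  · simp
  have hbdd : BddBelow (Set.range fun W : {W : Finset V // W.Nonempty} =>
      ((G.edgesToCompl (W.1 : Set V)).ncard : ℝ) / ((Δ : ℝ) * (W.1.card : ℝ))) :=
    ⟨0, Set.forall_mem_range.2 fun _ => by positivity⟩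
  have := hW.card_pos
  rw [mul_assoc, ← le_div_iff₀ (by positivity), ← ncard_edgesToCompl]
  exact ciInf_le hbdd ⟨W, hW⟩

theorem le_edgeIsoperimetricConstant [DecidableEq V] [Nonempty V] (hΔ : 0 < Δ) {φ : ℝ}
    (hφ : ∀ W : Finset V, φ * Δ * #W ≤ cutSize G W) : φ ≤ G.edgeIsoperimetricConstant Δ := by
  have : Nonempty {W : Finset V // W.Nonempty} := ⟨{Classical.arbitrary V}, singleton_nonempty _⟩
  refine le_ciInf fun W => ?_
  have := W.2.card_pos
  rw [le_div_iff₀ (by positivity), ncard_edgesToCompl, ← mul_assoc]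
  exact hφ W.1

theorem edgeIsoperimetricConstant_sq_div_two_mem (hreg : G.IsRegularOfDegree Δ) (hΔ : 0 < Δ) :
    G.edgeIsoperimetricConstant Δ ^ 2 / 2 ∈ G.spectralLowerBounds := by
  classical
  exact sq_div_two_mem_spectralLowerBounds hreg hΔ (edgeIsoperimetricConstant_nonneg G Δ)
    (edgeIsoperimetricConstant_mul_le hΔ)

theorem spectralBottom_pos_iff [Nonempty V] (hreg : G.IsRegularOfDegree Δ) (hΔ : 3 ≤ Δ) :
    0 < G.spectralBottom ↔ ¬ G.IsAmenableOfDegree Δ := by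
  classical
  have hΔ' : (3 : ℝ) ≤ Δ := by exact_mod_cast hΔ
  have hcheeger := edgeIsoperimetricConstant_sq_div_two_mem hreg (by lia)
  have hbot := isGreatest_spectralBottom ⟨_, hcheeger⟩
  refine ⟨fun h => ne_of_gt ?_, fun h => ?_⟩
  · have hle : G.spectralBottom * ((Δ - 1) / (Δ - 2)) ≤ G.edgeIsoperimetricConstant Δ :=
      le_edgeIsoperimetricConstant (by lia) fun W =>
        (mul_card_le_cutSize hreg hΔ hbot.1 h.le W).trans_eq' (by ring)
    exact (mul_pos h (div_pos (by linarith) (by linarith))).trans_le hle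
  · exact (half_pos (pow_pos ((edgeIsoperimetricConstant_nonneg G Δ).lt_of_ne' h) 2)).trans_le
      (hbot.2 hcheeger)

end Isoperimetry

theorem sqrt_lt_rpow_iff {b c l : ℝ} (hb : 1 < b) (hc : 0 < c) :
    √b < b ^ ((1 + c * l) / 2) ↔ 0 < l := by
  rw [Real.sqrt_eq_rpow, Real.rpow_lt_rpow_left_iff hb, div_lt_div_iff_of_pos_right two_pos,
    lt_add_iff_pos_right, mul_pos_iff_of_pos_left hc]

end ConnectiveConstant

open ConnectiveConstant

theorem mainTheorem3 {V : Type*} [Infinite V] (G : SimpleGraph V) [G.LocallyFinite]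
    (hconn : G.Connected) (htrans : G.IsVertexTransitive)
    (Δ : ℕ) (hreg : G.IsRegularOfDegree Δ) (hΔ : 3 ≤ Δ) (o : V) :
    -- the connective constant exists as a limit
    Filter.Tendsto (fun n : ℕ => (G.sawCount o n : ℝ) ^ (1 / (n : ℝ)))
      Filter.atTop (nhds (G.connectiveConstant o)) ∧
    -- the spectral bottom is attained as a maximum
    IsGreatest G.spectralLowerBounds G.spectralBottom ∧
    -- the lower bound for the connective constant
    ((Δ : ℝ) - 1) ^
        ((1 + ((Δ : ℝ) * ((Δ : ℝ) - 1) / ((Δ : ℝ) - 2) ^ 2) * G.spectralBottom) / 2)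
      ≤ G.connectiveConstant o ∧
    -- the bound is strictly better than `√(Δ - 1)` exactly for non-amenable graphs
    (Real.sqrt ((Δ : ℝ) - 1) <
        ((Δ : ℝ) - 1) ^
          ((1 + ((Δ : ℝ) * ((Δ : ℝ) - 1) / ((Δ : ℝ) - 2) ^ 2) * G.spectralBottom) / 2)
      ↔ ¬ G.IsAmenableOfDegree Δ) := by
  classical
  have hΔ' : (3 : ℝ) ≤ Δ := by exact_mod_cast hΔ
  have hbound := edgeIsoperimetricConstant_sq_div_two_mem hreg (by lia)
  have hbot := isGreatest_spectralBottom ⟨_, hbound⟩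
  have hbot₀ : 0 ≤ G.spectralBottom := le_trans (by positivity) (hbot.2 hbound)
  have hfactor : (0 : ℝ) ≤ Δ * (Δ - 1) / (Δ - 2) :=
    div_nonneg (mul_nonneg (by linarith) (by linarith)) (by linarith)
  obtain ⟨C, hC⟩ := exists_forall_rpow_le_sawCount htrans hreg hΔ
    (fun _ => le_cutSize hconn htrans hreg) (mul_nonneg hbot₀ hfactor)
    (mul_card_le_cutSize hreg hΔ hbot.1 hbot₀) o
  have hlim := tendsto_connectiveConstant htrans fun n =>
    Nat.cast_pos.1 ((Real.rpow_pos_of_pos (by linarith) _).trans_le (hC n))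
  refine ⟨hlim, hbot, ?_, ?_⟩
  · refine Eq.trans_le ?_ (rpow_le_of_tendsto_rpow_one_div (by linarith) hC hlim)
    rw [mul_comm _ G.spectralBottom, mul_div_assoc G.spectralBottom, div_div, ← sq]
  · rw [← spectralBottom_pos_iff hreg hΔ]
    refine sqrt_lt_rpow_iff (by linarith) (div_pos (mul_pos ?_ ?_) (pow_pos ?_ 2)) <;> linarith
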